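/- Let $A\in\mathbb R^{n\times n}$ be symmetric positive semidefinite, $b\in\mathbb R^n$, $\tau\ge 0$, and put $$f(x)=\tfrac12x^TAx-b^Tx,\qquad F(x)=f(x)+\tau\|x\|_1 ,\qquad x\in\mathbb R^n .$$ Assume that the set $\mathcal S^*$ of minimizers of $F$ over $\mathbb R^n$ is nonempty. Let $\partial F(x)$ be the subdifferential of $F$ at $x$ and $v(x)$ its element of least Euclidean norm. *Notation.* Let $I_0(x)$, $I_+(x)$, $I_-(x)$ be the sets of indices of the zero, positive and negative components of $x$, and $$I_0^0(x)=\{i\in I_0(x):0\in[\nabla_if(x)-\tau,\nabla_if(x)+\tau]\},$$ $$I_0^+(x)=\{i\in I_0(x):\nabla_if(x)+\tau<0\},\qquad I_0^-(x)=\{i\in I_0(x):\nabla_if(x)-\tau>0\}.$$ Let $c(x;\tau)\in\mathbb R^n$ have components $\tau$ on $I_+(x)\cup I_0^+(x)$, $0$ on $I_0^0(x)$, and $-\tau$ on $I_-(x)\cup I_0^-(x)$. For $J\subseteq\{1,\dots,n\}$ let $P_J$ be the Euclidean projection onto $\{x:x_j=0,\ j\in J\}$. Let $$\mathcal I^*=\{J: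 J\subseteq I_0(x^*)\text{ for some }x^*\in\mathcal S^*\},$$ and let $L(n)=1+\ell_{\max}$, where $\ell_{\max}$ is the largest $\ell$ for which there are $\ell$ distinct subsets of $\{1,\dots,n\}$ none of which belongs to $\mathcal I^*$. *TPCG1*$(A,b,c,J_0,J_-,J_+,x^0,\varepsilon)$. Let $\Omega=\{x: x_j=0\ (j\in J_0),\ x_j\le 0\ (j\in J_-),\ x_j\ge0\ (j\in J_+)\}$. Set $r^0=Ax^0-b+c$, $p^0=P_{J_0}r^0$, $d^0=-p^0$. For $k=0,1,\dots$ let $\alpha_k=\min\{\alpha_k^{\rm cg},\alpha_k^{\rm tc}\}$, where $\alpha^{\rm cg}_k=\|p^k\|^2/\big((d^k)^TAd^k\big)$ ($=\infty$ if $p^k\ne0$ and $(d^k)^TAd^k=0$) and $\alpha_k^{\rm tc}=\max\{\alpha:x^k+\alpha d^k\in\Omega\}$ ($=\infty$ if this set is unbounded above); set $x^{k+1}=x^k+\alpha_kd^k$; if $\alpha_k^{\rm cg}>\alpha_k$, return $x^{k+1}$; otherwise set $r^{k+1}=r^k+\alpha_kAd^k$ and $p^{k+1}=P_{J_0}r^{k+1}$;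 if $\|p^{k+1}\|_\infty\le\varepsilon$, return $x^{k+1}$; otherwise set $d^{k+1}=-p^{k+1}+\frac{\|p^{k+1}\|^2}{\|p^k\|^2}d^k$ and continue. *TPCG2*$(A,b,c,J_0,J_-,J_+,x^0,\varepsilon)$. Start with $(J_0^0,J_-^0,J_+^0)=(J_0,J_-,J_+)$. For $k=0,1,\dots$: if $\|P_{J_0^k}(Ax^k-b+c)\|_\infty\le\varepsilon$, return $x^k$; otherwise set $x^{k+1}=\mathrm{TPCG1}(A,b,c,J_0^k,J_-^k,J_+^k,x^k,\varepsilon)$ and $(J_0^{k+1},J_-^{k+1},J_+^{k+1})=(I_0(x^{k+1}),I_-(x^{k+1}),I_+(x^{k+1}))$. *GCG method 1*$(A,b,\tau,x^0,\varepsilon)$. For $k=0,1,\dots$: if $\|v(x^k)\|_\infty\le\varepsilon$, return $y=x^k$; otherwise, with $c^k=c(x^k;\tau)$, set $$x^{k+1}=\mathrm{TPCG2}\big(A,b,c^k,\ I_0^0(x^k),\ I_-(x^k)\cup I_0^-(x^k),\ I_+(x^k)\cup I_0^+(x^k),\ x^k,\ 0\big).$$ **Theorem.** Let $x^0\in\mathbb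 R^n$ and $\varepsilon\ge0$ be arbitrary. Then: (i) GCG method 1 started at $x^0$ (including all its calls of TPCG2 and TPCG1) is well defined and terminates, after at most $L(n)$ iterations, an iteration being the computation of $x^{k+1}$ from $x^k$ by TPCG2. (ii) Its output $y$ satisfies $\|s\|_\infty\le\varepsilon$ for some $s\in\partial F(y)$; moreover, if $\varepsilon=0$, then $y$ is a minimizer of $F$ over $\mathbb R^n$. -/

import Mathlib

open scoped RealInnerProductSpace

noncomputable section

namespace L1QP

variable {n : ℕ}

/-- `ℝⁿ` with its Euclidean norm and inner product. -/
abbrev Vec (n : ℕ) : Type := EuclideanSpace ℝ (Fin n)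

/-- The matrix-vector product `A x`. -/
def mulv (A : Matrix (Fin n) (Fin n) ℝ) (x : Vec n) : Vec n := WithLp.toLp 2 (A.mulVec x.ofLp)

/-- The `ℓ₁` norm. -/
def oneNorm (x : Vec n) : ℝ := ∑ i, |x i|

/-- The `ℓ_∞` norm (`Fin n → ℝ` carries the maximum norm). -/
def supNorm (x : Vec n) : ℝ := ‖(x.ofLp : Fin n → ℝ)‖

/-! ### The `ℓ₁`-regularized convex quadratic program -/

/-- The smooth part `f(x) = ½ xᵀ A x - bᵀ x`. -/
def f (A : Matrix (Fin n) (Fin n) ℝ) (b : Vec n) (x : Vec n) : ℝ :=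
  1 / 2 * ⟪x, mulv A x⟫ - ⟪b, x⟫

/-- The objective `F(x) = ½ xᵀ A x - bᵀ x + τ ‖x‖₁`. -/
def F (A : Matrix (Fin n) (Fin n) ℝ) (b : Vec n) (τ : ℝ) (x : Vec n) : ℝ :=
  f A b x + τ * oneNorm x

/-- The set of optimal solutions of `min F` over `ℝⁿ`. -/
def optimalSet (A : Matrix (Fin n) (Fin n) ℝ) (b : Vec n) (τ : ℝ) : Set (Vec n) :=
  {x | ∀ z, F A b τ x ≤ F A b τ z}

/-- The convex subdifferential of `g` at `x`. -/
def subdiff (g : Vec n → ℝ) (x : Vec n) : Set (Vec n) :=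
  {s | ∀ z, g x + ⟪s, z - x⟫ ≤ g z}

/-- `v` is the minimum-norm subgradient of `g` at `x`, that is, the point of the subdifferential
nearest to the origin in the Euclidean norm. -/
def IsMinNormSubgradient (g : Vec n → ℝ) (x v : Vec n) : Prop :=
  v ∈ subdiff g x ∧ ∀ s ∈ subdiff g x, ‖v‖ ≤ ‖s‖

/-! ### Index sets -/

/-- Indices of the negative components of `x`. -/
def Ineg (x : Vec n) : Set (Fin n) := {i | x i < 0}

/-- Indices of the positive components of `x`. -/
def Ipos (x : Vec n) : Set (Fin n) := {i | 0 < x i}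

/-- Indices of the zero components of `x`. -/
def Izero (x : Vec n) : Set (Fin n) := {i | x i = 0}

/-- `I₀⁰(x)`: zero components with `0 ∈ [∇ᵢ f(x) - τ, ∇ᵢ f(x) + τ]`. -/
def IzeroZero (A : Matrix (Fin n) (Fin n) ℝ) (b : Vec n) (τ : ℝ) (x : Vec n) : Set (Fin n) :=
  {i | i ∈ Izero x ∧ (0 : ℝ) ∈ Set.Icc (gradient (f A b) x i - τ) (gradient (f A b) x i + τ)}

/-- `I₀⁺(x)`: zero components with `∇ᵢ f(x) + τ < 0`. -/
def IzeroPos (A : Matrix (Fin n) (Fin n) ℝ) (b : Vec n) (τ : ℝ) (x : Vec n) : Set (Fin n) :=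
  {i | i ∈ Izero x ∧ gradient (f A b) x i + τ < 0}

/-- `I₀⁻(x)`: zero components with `∇ᵢ f(x) - τ > 0`. -/
def IzeroNeg (A : Matrix (Fin n) (Fin n) ℝ) (b : Vec n) (τ : ℝ) (x : Vec n) : Set (Fin n) :=
  {i | i ∈ Izero x ∧ 0 < gradient (f A b) x i - τ}

open Classical in
/-- The vector `c(x; τ)`. The three cases cover all indices and exclude one another. -/
def cvec (A : Matrix (Fin n) (Fin n) ℝ) (b : Vec n) (τ : ℝ) (x : Vec n) : Vec n :=
  WithLp.toLp 2 fun i =>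
    if i ∈ Ipos x ∪ IzeroPos A b τ x then τ
    else if i ∈ Ineg x ∪ IzeroNeg A b τ x then -τ
    else 0

/-- The family `𝓘*` of the index sets `J ⊆ I₀(x*)` with `x*` an optimal solution. -/
def Istar (A : Matrix (Fin n) (Fin n) ℝ) (b : Vec n) (τ : ℝ) : Set (Set (Fin n)) :=
  {J | ∃ x ∈ optimalSet A b τ, J ⊆ Izero x}

/-- `L(n)`: one plus the largest `ℓ` for which there are `ℓ` distinct subsets of the index set
outside `𝓘*`. (The set of such `ℓ` contains `0` and is bounded by `2 ^ n`.) -/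
def L (A : Matrix (Fin n) (Fin n) ℝ) (b : Vec n) (τ : ℝ) : ℕ :=
  sSup {l : ℕ | ∃ C : Fin l → Set (Fin n), Function.Injective C ∧ ∀ i, C i ∉ Istar A b τ} + 1

/-! ### Faces of orthants -/

/-- The coordinate subspace `{x | xⱼ = 0 for j ∈ J}`. -/
def coordSubspace (J : Set (Fin n)) : Submodule ℝ (Vec n) where
  carrier := {x | ∀ j ∈ J, x j = 0}
  add_mem' := by
    intro x y hx hy j hj
    simp [hx j hj, hy j hj]
  zero_mem' := by
    intro j _
    simp
  smul_mem' := by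
    intro a x hx j hj
    simp [hx j hj]

/-- The Euclidean projection onto `{x | xⱼ = 0 for j ∈ J}`. -/
def proj (J : Set (Fin n)) (x : Vec n) : Vec n := (coordSubspace J).starProjection x

/-- The face `Ω` given by `xⱼ = 0` on `J₀`, `xⱼ ≤ 0` on `J₋`, `xⱼ ≥ 0` on `J₊`. -/
def face (J0 Jneg Jpos : Set (Fin n)) : Set (Vec n) :=
  {x | (∀ j ∈ J0, x j = 0) ∧ (∀ j ∈ Jneg, x j ≤ 0) ∧ (∀ j ∈ Jpos, 0 ≤ x j)}

/-! ### First truncated projected CG method (TPCG1) -/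

open Classical in
/-- The CG step length `‖p‖² / (dᵀ A d)`, which is `∞` if `p ≠ 0` and `dᵀ A d = 0`. -/
def alphaCG (A : Matrix (Fin n) (Fin n) ℝ) (p d : Vec n) : EReal :=
  if p ≠ 0 ∧ ⟪d, mulv A d⟫ = 0 then ⊤ else ((‖p‖ ^ 2 / ⟪d, mulv A d⟫ : ℝ) : EReal)

/-- The truncation step length `max {α | x + α d ∈ Ω}`, which is `∞` if that set is unbounded
above. -/
def alphaTC (Ω : Set (Vec n)) (x d : Vec n) : EReal :=
  sSup ((fun α : ℝ => (α : EReal)) '' {α : ℝ | x + α • d ∈ Ω})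

/-- `TPCG1Loop A J₀ J₋ J₊ ε x r p d y`: the loop of TPCG1, entered with current values
`xᵏ = x`, `rᵏ = r`, `pᵏ = p`, `dᵏ = d`, terminates with output `y`. The step length
`α = min(α_cg, α_tc)` has to be finite for an iteration to be carried out. -/
inductive TPCG1Loop (A : Matrix (Fin n) (Fin n) ℝ) (J0 Jneg Jpos : Set (Fin n)) (ε : ℝ) :
    Vec n → Vec n → Vec n → Vec n → Vec n → Prop
  | cross {x r p d : Vec n} {α : ℝ}
      (hα : (α : EReal) = min (alphaCG A p d) (alphaTC (face J0 Jneg Jpos) x d))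
      (hcut : (α : EReal) < alphaCG A p d) :
      TPCG1Loop A J0 Jneg Jpos ε x r p d (x + α • d)
  | converged {x r p d r' p' : Vec n} {α : ℝ}
      (hα : (α : EReal) = min (alphaCG A p d) (alphaTC (face J0 Jneg Jpos) x d))
      (hfull : ¬ (α : EReal) < alphaCG A p d)
      (hr : r' = r + α • mulv A d)
      (hp : p' = proj J0 r')
      (hsmall : supNorm p' ≤ ε) :
      TPCG1Loop A J0 Jneg Jpos ε x r p d (x + α • d)
  | iterate {x r p d r' p' y : Vec n} {α : ℝ}
      (hα : (α : EReal) = min (alphaCG A p d) (alphaTC (face J0 Jneg Jpos) x d))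
      (hfull : ¬ (α : EReal) < alphaCG A p d)
      (hr : r' = r + α • mulv A d)
      (hp : p' = proj J0 r')
      (hlarge : ¬ supNorm p' ≤ ε)
      (hrest : TPCG1Loop A J0 Jneg Jpos ε
        (x + α • d) r' p' (-p' + (‖p'‖ ^ 2 / ‖p‖ ^ 2) • d) y) :
      TPCG1Loop A J0 Jneg Jpos ε x r p d y

/-- `TPCG1(A, b, c, J₀, J₋, J₊, x⁰, ε)` terminates with output `y`. -/
def TPCG1 (A : Matrix (Fin n) (Fin n) ℝ) (b c : Vec n) (J0 Jneg Jpos : Set (Fin n))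
    (x0 : Vec n) (ε : ℝ) (y : Vec n) : Prop :=
  TPCG1Loop A J0 Jneg Jpos ε x0 (mulv A x0 - b + c) (proj J0 (mulv A x0 - b + c))
    (-proj J0 (mulv A x0 - b + c)) y

/-! ### Second truncated projected CG method (TPCG2) -/

/-- `TPCG2 A b c ε J₀ J₋ J₊ x y`: the method TPCG2 started at `x` on the face given by
`J₀, J₋, J₊` terminates with output `y`. After each call of TPCG1 the index sets are replaced by
those of the new iterate, and the loop is entered again. -/
inductive TPCG2 (A : Matrix (Fin n) (Fin n) ℝ) (b c : Vec n) (ε : ℝ) :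
    Set (Fin n) → Set (Fin n) → Set (Fin n) → Vec n → Vec n → Prop
  | halt {J0 Jneg Jpos : Set (Fin n)} {x : Vec n}
      (hsmall : supNorm (proj J0 (mulv A x - b + c)) ≤ ε) :
      TPCG2 A b c ε J0 Jneg Jpos x x
  | iterate {J0 Jneg Jpos : Set (Fin n)} {x x' y : Vec n}
      (hlarge : ¬ supNorm (proj J0 (mulv A x - b + c)) ≤ ε)
      (hcall : TPCG1 A b c J0 Jneg Jpos x ε x')
      (hrest : TPCG2 A b c ε (Izero x') (Ineg x') (Ipos x') x' y) :
      TPCG2 A b c ε J0 Jneg Jpos x y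

/-! ### Generalized conjugate gradient method 1 -/

/-- `GCG1 A b τ ε k x y`: GCG method 1 started at `x` with tolerance `ε` terminates with output
`y` after exactly `k` iterations, i.e. after `k` updates of the iterate by TPCG2 (always called
with tolerance `0`). -/
inductive GCG1 (A : Matrix (Fin n) (Fin n) ℝ) (b : Vec n) (τ ε : ℝ) :
    ℕ → Vec n → Vec n → Prop
  | halt {x v : Vec n}
      (hv : IsMinNormSubgradient (F A b τ) x v)
      (hsmall : supNorm v ≤ ε) :
      GCG1 A b τ ε 0 x x
  | iterate {k : ℕ} {x v x' y : Vec n}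
      (hv : IsMinNormSubgradient (F A b τ) x v)
      (hlarge : ¬ supNorm v ≤ ε)
      (hcall : TPCG2 A b (cvec A b τ x) 0
        (IzeroZero A b τ x) (Ineg x ∪ IzeroNeg A b τ x) (Ipos x ∪ IzeroPos A b τ x) x x')
      (hrest : GCG1 A b τ ε k x' y) :
      GCG1 A b τ ε (k + 1) x y

end L1QP

end

/-! An iteration started at `x` works on a face where `F` coincides with the quadratic `quad` for `c
= cvec A b τ x` (`quad_eq_F`); since the entries of `c` lie in `[-τ, τ]`, this quadratic minorizes
`F` everywhere (`quad_le_F`). The minimum-norm subgradient is the projected gradient of that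
quadratic, and its negative is a feasible direction. So if it is nonzero, the first CG step already
decreases `F` strictly.

TPCG2 stops at a `y` where the gradient of the quadratic vanishes off `Izero y`. By convexity and
the minorization, `y` minimizes `F` over all vectors vanishing on `Izero y` (`iteration_spec`). The
value at such a point depends only on its zero set, so strict descent never repeats a zero set. If
the zero set lies in `Istar`, the subspace contains an optimal solution, so `y` is optimal and the
method stops. Hence all computed iterates but the last have distinct zero sets outside `Istar`,
which gives `L`.

The inner loops are finite because CG directions span strictly growing Krylov spaces (`Krylov.next`)
and each truncation after a restart creates a new zero. Step lengths are finite because the optimal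
value bounds the quadratic below on the face. -/

namespace L1QP

variable {n : ℕ} {A : Matrix (Fin n) (Fin n) ℝ} {b c : Vec n} {τ ε : ℝ}
  {J0 Jneg Jpos : Set (Fin n)}

/-! ### Matrix products, inner products and coordinate projections -/

theorem mulv_add (x y : Vec n) : mulv A (x + y) = mulv A x + mulv A y := by
  ext i; simp [mulv, Matrix.mulVec_add]

theorem mulv_smul (a : ℝ) (x : Vec n) : mulv A (a • x) = a • mulv A x := by
  ext i; simp [mulv, Matrix.mulVec_smul]

theorem mulv_neg (x : Vec n) : mulv A (-x) = -mulv A x := by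
  ext i; simp [mulv, Matrix.mulVec_neg]

theorem inner_eq_sum (x y : Vec n) : ⟪x, y⟫ = ∑ i, x i * y i := by
  simp [PiLp.inner_apply, mul_comm]

theorem inner_mulv_comm (hA : A.PosSemidef) (x y : Vec n) :
    ⟪x, mulv A y⟫ = ⟪y, mulv A x⟫ := by
  have hsymm : ∀ i j, A i j = A j i := fun i j => by simpa using hA.isHermitian.apply j i
  simp only [inner_eq_sum, mulv, Matrix.mulVec, dotProduct, Finset.mul_sum]
  rw [Finset.sum_comm]
  refine Finset.sum_congr rfl fun i _ => Finset.sum_congr rfl fun j _ => ?_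
  rw [hsymm j i]; ring

theorem inner_mulv_self_nonneg (hA : A.PosSemidef) (x : Vec n) : 0 ≤ ⟪x, mulv A x⟫ := by
  have h := hA.dotProduct_mulVec_nonneg x.ofLp
  simpa [inner_eq_sum, mulv, dotProduct] using h

theorem supNorm_le_zero_iff (x : Vec n) : supNorm x ≤ 0 ↔ x = 0 := by
  unfold supNorm
  rw [norm_le_zero_iff]
  simp

open Classical in
theorem proj_apply (J : Set (Fin n)) (x : Vec n) (i : Fin n) :
    proj J x i = if i ∈ J then 0 else x i := by
  have h : (coordSubspace J).starProjection x
      = WithLp.toLp 2 (fun i => if i ∈ J then 0 else x i) := by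
    refine Submodule.eq_starProjection_of_mem_of_inner_eq_zero ?_ ?_
    · intro j hj; simp [hj]
    · intro w hw
      rw [inner_eq_sum]
      refine Finset.sum_eq_zero fun i _ => ?_
      by_cases hi : i ∈ J
      · simp [hw i hi]
      · simp [hi]
  simp [proj, h]

theorem proj_mem (J : Set (Fin n)) (x : Vec n) : proj J x ∈ coordSubspace J :=
  Submodule.starProjection_apply_mem _ _

theorem proj_add (J : Set (Fin n)) (x y : Vec n) : proj J (x + y) = proj J x + proj J y :=
  map_add _ _ _

theorem proj_smul (J : Set (Fin n)) (a : ℝ) (x : Vec n) : proj J (a • x) = a • proj J x :=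
  map_smul _ _ _

theorem inner_proj_left {J : Set (Fin n)} (x : Vec n) {z : Vec n} (hz : z ∈ coordSubspace J) :
    ⟪proj J x, z⟫ = ⟪x, z⟫ := by
  classical
  rw [inner_eq_sum, inner_eq_sum]
  refine Finset.sum_congr rfl fun i _ => ?_
  rw [proj_apply]
  split_ifs with hi
  · simp [hz i hi]
  · rfl

/-- The quadratic `f(x) + cᵀ x` minimized by TPCG1 and TPCG2. -/
noncomputable def quad (A : Matrix (Fin n) (Fin n) ℝ) (b c x : Vec n) : ℝ := f A b x + ⟪c, x⟫

theorem quad_add (hA : A.PosSemidef) (x d : Vec n) :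
    quad A b c (x + d) =
      quad A b c x + ⟪mulv A x - b + c, d⟫ + 1 / 2 * ⟪d, mulv A d⟫ := by
  simp only [quad, f, mulv_add, inner_add_left, inner_add_right, inner_sub_left]
  rw [inner_mulv_comm hA x d, real_inner_comm d (mulv A x)]
  ring

theorem quad_add_smul (hA : A.PosSemidef) (x d : Vec n) (α : ℝ) :
    quad A b c (x + α • d) =
      quad A b c x + α * ⟪mulv A x - b + c, d⟫ + α ^ 2 / 2 * ⟪d, mulv A d⟫ := by
  rw [quad_add hA, mulv_smul]
  simp only [inner_smul_left, inner_smul_right]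
  simp
  ring

/-! ### Step lengths -/

theorem alphaCG_of_pos {p d : Vec n} (h : ⟪d, mulv A d⟫ ≠ 0) :
    alphaCG A p d = ((‖p‖ ^ 2 / ⟪d, mulv A d⟫ : ℝ) : EReal) := by
  rw [alphaCG, if_neg]; exact fun h' => h h'.2

theorem alphaCG_pos (hA : A.PosSemidef) {p d : Vec n} (hp : p ≠ 0) : 0 < alphaCG A p d := by
  by_cases h : ⟪d, mulv A d⟫ = 0
  · rw [alphaCG, if_pos ⟨hp, h⟩]; exact EReal.coe_lt_top 0
  · rw [alphaCG_of_pos h]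
    have h1 := lt_of_le_of_ne (inner_mulv_self_nonneg hA d) (Ne.symm h)
    have h2 := norm_pos_iff.2 hp
    exact_mod_cast (by positivity : 0 < ‖p‖ ^ 2 / ⟪d, mulv A d⟫)

theorem mul_inner_le_of_le_alphaCG (hA : A.PosSemidef) {p d : Vec n} {α : ℝ}
    (h : (α : EReal) ≤ alphaCG A p d) : α * ⟪d, mulv A d⟫ ≤ ‖p‖ ^ 2 := by
  by_cases h0 : ⟪d, mulv A d⟫ = 0
  · rw [h0]; simp
  · rw [alphaCG_of_pos h0, EReal.coe_le_coe_iff] at h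
    have h1 := lt_of_le_of_ne (inner_mulv_self_nonneg hA d) (Ne.symm h0)
    rwa [le_div_iff₀ h1] at h

theorem mul_inner_eq_of_eq_alphaCG {p d : Vec n} (hp : p ≠ 0) {α : ℝ}
    (h : (α : EReal) = alphaCG A p d) : α * ⟪d, mulv A d⟫ = ‖p‖ ^ 2 := by
  by_cases h0 : ⟪d, mulv A d⟫ = 0
  · rw [alphaCG, if_pos ⟨hp, h0⟩] at h
    exact absurd h (EReal.coe_ne_top α)
  · rw [alphaCG_of_pos h0, EReal.coe_eq_coe_iff] at h
    rw [h, div_mul_cancel₀ _ h0]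

theorem le_alphaTC {Ω : Set (Vec n)} {x d : Vec n} {t : ℝ} (h : x + t • d ∈ Ω) :
    (t : EReal) ≤ alphaTC Ω x d :=
  le_sSup ⟨t, h, rfl⟩

theorem alphaTC_nonneg {Ω : Set (Vec n)} {x d : Vec n} (h : x ∈ Ω) : 0 ≤ alphaTC Ω x d := by
  have := le_alphaTC (Ω := Ω) (x := x) (d := d) (t := 0) (by simpa using h)
  simpa using this

/-- The truncation step length is attained, and so is every smaller one. -/
theorem add_smul_mem_face_of_le_alphaTC {x d : Vec n} (hx : x ∈ face J0 Jneg Jpos)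
    (hd : d ∈ coordSubspace J0) {α : ℝ} (h0 : 0 ≤ α)
    (h : (α : EReal) ≤ alphaTC (face J0 Jneg Jpos) x d) :
    x + α • d ∈ face J0 Jneg Jpos := by
  -- `alphaTC` is a supremum, so feasible points are only known beyond each `β < α`. Below, `β` is
  -- the step at which a supposedly violated coordinate reaches zero.
  have key : ∀ β < α, ∃ γ, β < γ ∧ x + γ • d ∈ face J0 Jneg Jpos := by
    intro β hβ
    have h1 : (β : EReal) < alphaTC (face J0 Jneg Jpos) x d :=
      lt_of_lt_of_le (EReal.coe_lt_coe_iff.2 hβ) h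
    obtain ⟨_, ⟨γ, hγ, rfl⟩, h2⟩ := lt_sSup_iff.1 h1
    exact ⟨γ, EReal.coe_lt_coe_iff.1 h2, hγ⟩
  refine ⟨fun j hj => by simp [hx.1 j hj, hd j hj], fun j hj => ?_, fun j hj => ?_⟩
  · have hxj := hx.2.1 j hj
    by_contra! hneg
    simp only [PiLp.add_apply, PiLp.smul_apply, smul_eq_mul] at hneg
    have hdj : 0 < d j := by
      by_contra! hle
      nlinarith
    obtain ⟨γ, hγ, hmem⟩ := key (-x j / d j) (by rw [div_lt_iff₀ hdj]; linarith)
    have h3 := hmem.2.1 j hj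
    simp only [PiLp.add_apply, PiLp.smul_apply, smul_eq_mul] at h3
    rw [div_lt_iff₀ hdj] at hγ
    linarith
  · have hxj := hx.2.2 j hj
    by_contra! hneg
    simp only [PiLp.add_apply, PiLp.smul_apply, smul_eq_mul] at hneg
    have hdj : 0 < -d j := by
      by_contra! hle
      nlinarith
    obtain ⟨γ, hγ, hmem⟩ := key (x j / (-d j)) (by rw [div_lt_iff₀ hdj]; linarith)
    have h3 := hmem.2.2 j hj
    simp only [PiLp.add_apply, PiLp.smul_apply, smul_eq_mul] at h3
    rw [div_lt_iff₀ hdj] at hγ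
    linarith

/-- A direction is feasible if it points inwards at all active inequality constraints. -/
theorem exists_pos_add_smul_mem_face {x d : Vec n} (hx : x ∈ face J0 Jneg Jpos)
    (hd : d ∈ coordSubspace J0) (hneg : ∀ j ∈ Jneg, x j = 0 → d j ≤ 0)
    (hpos : ∀ j ∈ Jpos, x j = 0 → 0 ≤ d j) :
    ∃ δ > (0 : ℝ), ∀ t : ℝ, 0 ≤ t → t ≤ δ → x + t • d ∈ face J0 Jneg Jpos := by
  -- Inactive constraints persist by continuity, active ones by the sign of `d`; there are finitely
  -- many.
  have key : ∀ᶠ t in nhdsWithin (0 : ℝ) (Set.Ici 0), x + t • d ∈ face J0 Jneg Jpos := by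
    have hcont : ∀ j, Filter.Tendsto (fun t : ℝ => x j + t * d j)
        (nhdsWithin (0 : ℝ) (Set.Ici 0)) (nhds (x j)) := fun j => by
      have : Continuous fun t : ℝ => x j + t * d j := by fun_prop
      simpa using (this.tendsto 0).mono_left nhdsWithin_le_nhds
    have h1 : ∀ᶠ t in nhdsWithin (0 : ℝ) (Set.Ici 0), ∀ j,
        (j ∈ Jneg → x j + t * d j ≤ 0) ∧ (j ∈ Jpos → 0 ≤ x j + t * d j) := by
      rw [Filter.eventually_all]
      intro j
      refine Filter.Eventually.and ?_ ?_
      · by_cases hj : j ∈ Jneg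
        · rcases (hx.2.1 j hj).lt_or_eq with h | h
          · filter_upwards [(hcont j).eventually (eventually_lt_nhds h)] with t ht _ using ht.le
          · filter_upwards [self_mem_nhdsWithin] with t ht _
            rw [h, zero_add]
            exact mul_nonpos_of_nonneg_of_nonpos ht (hneg j hj h)
        · exact Filter.Eventually.of_forall fun t h => absurd h hj
      · by_cases hj : j ∈ Jpos
        · rcases (hx.2.2 j hj).lt_or_eq with h | h
          · filter_upwards [(hcont j).eventually (eventually_gt_nhds h)] with t ht _ using ht.le
          · filter_upwards [self_mem_nhdsWithin] with t ht _
            rw [← h, zero_add]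
            exact mul_nonneg ht (hpos j hj h.symm)
        · exact Filter.Eventually.of_forall fun t h => absurd h hj
    filter_upwards [h1] with t ht
    exact ⟨fun j hj => by simp [hx.1 j hj, hd j hj], fun j hj => by simpa using (ht j).1 hj,
      fun j hj => by simpa using (ht j).2 hj⟩
  obtain ⟨δ, hδ, h⟩ := (mem_nhdsGE_iff_exists_Icc_subset).1 key
  exact ⟨δ, hδ, fun t h0 h1 => h ⟨h0, h1⟩⟩

/-- At a truncation an inequality constraint becomes active. -/
theorem exists_active_of_eq_alphaTC {x d : Vec n} (hx : x ∈ face J0 Jneg Jpos)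
    (hd : d ∈ coordSubspace J0) {α : ℝ} (h0 : 0 ≤ α)
    (h : (α : EReal) = alphaTC (face J0 Jneg Jpos) x d) :
    ∃ j ∈ Jneg ∪ Jpos, (x + α • d) j = 0 := by
  -- With no active inequality at the endpoint every direction is inward, so a longer step would be
  -- feasible.
  by_contra! hne
  obtain ⟨δ, hδ, hmem⟩ := exists_pos_add_smul_mem_face
    (add_smul_mem_face_of_le_alphaTC hx hd h0 h.le) hd
    (fun j hj hz => absurd hz (hne j (Or.inl hj))) (fun j hj hz => absurd hz (hne j (Or.inr hj)))
  have h1 := hmem δ (le_of_lt hδ) le_rfl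
  rw [add_assoc, ← add_smul] at h1
  have h2 := le_alphaTC h1
  rw [← h, EReal.coe_le_coe_iff] at h2
  linarith

/-! ### The conjugate gradient loop -/

/-- The relations between iterate, residual, projected residual and direction that hold whenever
the loop of TPCG1 is entered. -/
structure CGState (A : Matrix (Fin n) (Fin n) ℝ) (b c : Vec n) (J0 Jneg Jpos : Set (Fin n))
    (x r p d : Vec n) : Prop where
  mem_face : x ∈ face J0 Jneg Jpos
  residual : r = mulv A x - b + c
  projected : p = proj J0 r
  ne_zero : p ≠ 0
  dir_mem : d ∈ coordSubspace J0
  inner_dir : ⟪p, d⟫ = -‖p‖ ^ 2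

namespace CGState

variable {x r p d : Vec n} {α : ℝ}

theorem initial {x : Vec n} (hx : x ∈ face J0 Jneg Jpos)
    (h : proj J0 (mulv A x - b + c) ≠ 0) :
    CGState A b c J0 Jneg Jpos x (mulv A x - b + c) (proj J0 (mulv A x - b + c))
      (-proj J0 (mulv A x - b + c)) :=
  ⟨hx, rfl, rfl, h, neg_mem (proj_mem _ _), by simp⟩

theorem slope (S : CGState A b c J0 Jneg Jpos x r p d) :
    ⟪mulv A x - b + c, d⟫ = -‖p‖ ^ 2 := by
  rw [← S.inner_dir, S.projected, inner_proj_left _ S.dir_mem, S.residual]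

theorem norm_sq_pos (S : CGState A b c J0 Jneg Jpos x r p d) : 0 < ‖p‖ ^ 2 := by
  have := norm_pos_iff.2 S.ne_zero
  positivity

theorem step_nonneg (S : CGState A b c J0 Jneg Jpos x r p d) (hA : A.PosSemidef)
    (hα : (α : EReal) = min (alphaCG A p d) (alphaTC (face J0 Jneg Jpos) x d)) : 0 ≤ α := by
  have h : (0 : EReal) ≤ α := by
    rw [hα]; exact le_min (alphaCG_pos hA S.ne_zero).le (alphaTC_nonneg S.mem_face)
  exact_mod_cast h

theorem step_pos (S : CGState A b c J0 Jneg Jpos x r p d) (hA : A.PosSemidef)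
    (hα : (α : EReal) = min (alphaCG A p d) (alphaTC (face J0 Jneg Jpos) x d))
    (h : ∃ t : ℝ, 0 < t ∧ x + t • d ∈ face J0 Jneg Jpos) : 0 < α := by
  obtain ⟨t, ht, hmem⟩ := h
  have h : (0 : EReal) < α := by
    rw [hα]
    exact lt_min (alphaCG_pos hA S.ne_zero)
      (lt_of_lt_of_le (by exact_mod_cast ht) (le_alphaTC hmem))
  exact_mod_cast h

theorem step_mem (S : CGState A b c J0 Jneg Jpos x r p d) (hA : A.PosSemidef)
    (hα : (α : EReal) = min (alphaCG A p d) (alphaTC (face J0 Jneg Jpos) x d)) :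
    x + α • d ∈ face J0 Jneg Jpos :=
  add_smul_mem_face_of_le_alphaTC S.mem_face S.dir_mem (S.step_nonneg hA hα)
    (hα.le.trans (min_le_right _ _))

/-- The linear term is `-α‖p‖²`; since `α` is at most the CG step, the curvature term takes back at
most half of it. -/
theorem quad_step_le (S : CGState A b c J0 Jneg Jpos x r p d) (hA : A.PosSemidef)
    (hα : (α : EReal) = min (alphaCG A p d) (alphaTC (face J0 Jneg Jpos) x d)) :
    quad A b c (x + α • d) ≤ quad A b c x - α / 2 * ‖p‖ ^ 2 := by
  have h1 := mul_inner_le_of_le_alphaCG hA (hα.le.trans (min_le_left _ _))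
  have h2 := mul_le_mul_of_nonneg_left h1 (S.step_nonneg hA hα)
  rw [quad_add_smul hA, S.slope]
  linarith

theorem quad_step_lt (S : CGState A b c J0 Jneg Jpos x r p d) (hA : A.PosSemidef)
    (hα : (α : EReal) = min (alphaCG A p d) (alphaTC (face J0 Jneg Jpos) x d))
    (h : ∃ t : ℝ, 0 < t ∧ x + t • d ∈ face J0 Jneg Jpos) :
    quad A b c (x + α • d) < quad A b c x := by
  have h1 := S.quad_step_le hA hα
  have h2 := mul_pos (S.step_pos hA hα h) S.norm_sq_pos
  linarith

theorem quad_step_le' (S : CGState A b c J0 Jneg Jpos x r p d) (hA : A.PosSemidef)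
    (hα : (α : EReal) = min (alphaCG A p d) (alphaTC (face J0 Jneg Jpos) x d)) :
    quad A b c (x + α • d) ≤ quad A b c x := by
  have h1 := S.quad_step_le hA hα
  have h2 := mul_nonneg (S.step_nonneg hA hα) S.norm_sq_pos.le
  linarith

/-- Boundedness from below on the face makes the step length finite. -/
theorem exists_step (S : CGState A b c J0 Jneg Jpos x r p d) (hA : A.PosSemidef)
    (hbdd : BddBelow (quad A b c '' face J0 Jneg Jpos)) :
    ∃ α : ℝ, (α : EReal) = min (alphaCG A p d) (alphaTC (face J0 Jneg Jpos) x d) := by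
  have hbot : min (alphaCG A p d) (alphaTC (face J0 Jneg Jpos) x d) ≠ ⊥ :=
    (lt_of_lt_of_le EReal.bot_lt_zero
      (le_min (alphaCG_pos hA S.ne_zero).le (alphaTC_nonneg S.mem_face))).ne'
  have htop : min (alphaCG A p d) (alphaTC (face J0 Jneg Jpos) x d) ≠ ⊤ := by
    intro h
    obtain ⟨h1, h2⟩ := min_eq_top.1 h
    have h0 : ⟪d, mulv A d⟫ = 0 := by
      by_contra h0
      rw [alphaCG_of_pos h0] at h1
      exact EReal.coe_ne_top _ h1
    obtain ⟨m, hm⟩ := hbdd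
    -- Both step lengths being infinite, the whole ray is feasible and the quadratic is affine along
    -- it with slope `-‖p‖²`.
    have hray : ∀ t : ℝ, 0 ≤ t → m ≤ quad A b c x - t * ‖p‖ ^ 2 := by
      intro t ht
      have h3 := hm ⟨_, add_smul_mem_face_of_le_alphaTC S.mem_face S.dir_mem ht
        (by rw [h2]; exact le_top), rfl⟩
      rw [quad_add_smul hA, S.slope, h0] at h3
      linarith
    have h4 := hray 0 le_rfl
    -- At this step length the value would be `m - 1`.
    have h5 := hray ((quad A b c x - m + 1) / ‖p‖ ^ 2)
      (div_nonneg (by linarith) S.norm_sq_pos.le)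
    rw [div_mul_cancel₀ _ S.norm_sq_pos.ne'] at h5
    linarith
  exact ⟨_, EReal.coe_toReal htop hbot⟩

theorem eq_alphaCG
    (hα : (α : EReal) = min (alphaCG A p d) (alphaTC (face J0 Jneg Jpos) x d))
    (hfull : ¬ (α : EReal) < alphaCG A p d) : (α : EReal) = alphaCG A p d :=
  le_antisymm (hα.le.trans (min_le_left _ _)) (not_lt.1 hfull)

theorem eq_alphaTC
    (hα : (α : EReal) = min (alphaCG A p d) (alphaTC (face J0 Jneg Jpos) x d))
    (hcut : (α : EReal) < alphaCG A p d) :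
    (α : EReal) = alphaTC (face J0 Jneg Jpos) x d := by
  rcases min_choice (alphaCG A p d) (alphaTC (face J0 Jneg Jpos) x d) with h | h
  · rw [h] at hα; exact absurd hα hcut.ne
  · rw [h] at hα; exact hα

theorem projected_step (S : CGState A b c J0 Jneg Jpos x r p d) :
    proj J0 (r + α • mulv A d) = p + α • proj J0 (mulv A d) := by
  rw [proj_add, proj_smul, ← S.projected]

theorem residual_step (S : CGState A b c J0 Jneg Jpos x r p d) :
    r + α • mulv A d = mulv A (x + α • d) - b + c := by
  rw [S.residual, mulv_add, mulv_smul]; abel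

/-- Exact line search: the slope along `d` vanishes at the end of a full CG step. -/
theorem inner_projected_step (S : CGState A b c J0 Jneg Jpos x r p d)
    (h : (α : EReal) = alphaCG A p d) : ⟪proj J0 (r + α • mulv A d), d⟫ = 0 := by
  rw [S.projected_step, inner_add_left, S.inner_dir, inner_smul_left,
    inner_proj_left _ S.dir_mem, real_inner_comm]
  have := mul_inner_eq_of_eq_alphaCG S.ne_zero h
  simp only [conj_trivial]
  linarith

theorem next (S : CGState A b c J0 Jneg Jpos x r p d) (hA : A.PosSemidef)
    (hα : (α : EReal) = min (alphaCG A p d) (alphaTC (face J0 Jneg Jpos) x d))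
    (hfull : ¬ (α : EReal) < alphaCG A p d) {p' : Vec n}
    (hp : p' = proj J0 (r + α • mulv A d)) (hne : p' ≠ 0) :
    CGState A b c J0 Jneg Jpos (x + α • d) (r + α • mulv A d) p'
      (-p' + (‖p'‖ ^ 2 / ‖p‖ ^ 2) • d) where
  mem_face := S.step_mem hA hα
  residual := S.residual_step
  projected := hp
  ne_zero := hne
  dir_mem := add_mem (neg_mem (hp ▸ proj_mem _ _)) (Submodule.smul_mem _ _ S.dir_mem)
  inner_dir := by
    rw [inner_add_right, inner_smul_right, hp, S.inner_projected_step (eq_alphaCG hα hfull)]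
    simp

end CGState

/-- What every terminating run of the loop of TPCG1 with tolerance `0` achieves. -/
theorem TPCG1Loop.spec (hA : A.PosSemidef) {x r p d y : Vec n}
    (h : TPCG1Loop A J0 Jneg Jpos 0 x r p d y) (S : CGState A b c J0 Jneg Jpos x r p d) :
    y ∈ face J0 Jneg Jpos ∧ quad A b c y ≤ quad A b c x ∧
    ((∃ t : ℝ, 0 < t ∧ x + t • d ∈ face J0 Jneg Jpos) → quad A b c y < quad A b c x) ∧
    (proj J0 (mulv A y - b + c) = 0 ∨ ∃ j ∈ Jneg ∪ Jpos, y j = 0) := by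
  induction h with
  | cross hα hcut =>
    exact ⟨S.step_mem hA hα, S.quad_step_le' hA hα, S.quad_step_lt hA hα,
      Or.inr (exists_active_of_eq_alphaTC S.mem_face S.dir_mem (S.step_nonneg hA hα)
        (CGState.eq_alphaTC hα hcut))⟩
  | converged hα hfull hr hp hsmall =>
    refine ⟨S.step_mem hA hα, S.quad_step_le' hA hα, S.quad_step_lt hA hα, Or.inl ?_⟩
    rw [← S.residual_step, ← hr, ← hp]
    exact (supNorm_le_zero_iff _).1 hsmall
  | iterate hα hfull hr hp hlarge hrest ih =>
    subst hr
    rw [supNorm_le_zero_iff] at hlarge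
    obtain ⟨h1, h2, -, h4⟩ := ih (S.next hA hα hfull hp hlarge)
    -- Strictness comes from the first step alone; later steps need only not increase the quadratic.
    exact ⟨h1, h2.trans (S.quad_step_le' hA hα), fun h => h2.trans_lt (S.quad_step_lt hA hα h),
      h4⟩

/-! ### Krylov spaces and finite termination of CG -/

/-- The orthogonality and conjugacy relations between the current projected residual `p`, the
current direction `d` and the span `W` of the previous ones. -/
structure Krylov (A : Matrix (Fin n) (Fin n) ℝ) (J0 : Set (Fin n)) (p d : Vec n)
    (W : Submodule ℝ (Vec n)) : Prop where
  le : W ≤ coordSubspace J0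
  orthogonal : ∀ w ∈ W, ⟪p, w⟫ = 0
  add_mem : p + d ∈ W
  conjugate : ∀ w ∈ W, ⟪w, mulv A d⟫ = 0
  image : ∀ w ∈ W, proj J0 (mulv A w) ∈ W ⊔ Submodule.span ℝ {d}

theorem Krylov.initial (p : Vec n) : Krylov A J0 p (-p) ⊥ where
  le := bot_le
  orthogonal := by simp
  add_mem := by simp
  conjugate := by simp
  image := by
    intro w hw
    rw [(Submodule.mem_bot ℝ).1 hw]
    have : mulv A (0 : Vec n) = 0 := by simpa using mulv_smul (A := A) 0 (0 : Vec n)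
    simp [this, proj]

/-- Otherwise `p = (p + d) - d` would lie in `W`, to which it is orthogonal. -/
theorem Krylov.dir_notMem {W : Submodule ℝ (Vec n)} {p d : Vec n} (K : Krylov A J0 p d W)
    (hp : p ≠ 0) : d ∉ W := by
  intro hd
  have h : p ∈ W := by simpa using W.sub_mem K.add_mem hd
  exact hp (inner_self_eq_zero.1 (K.orthogonal p h))

theorem Krylov.finrank_lt {W : Submodule ℝ (Vec n)} {p d : Vec n} (K : Krylov A J0 p d W)
    (hp : p ≠ 0) : Module.finrank ℝ W < Module.finrank ℝ ↥(W ⊔ Submodule.span ℝ {d}) := by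
  refine Submodule.finrank_lt_finrank_of_lt (lt_of_le_of_ne le_sup_left fun h => ?_)
  refine K.dir_notMem hp ?_
  rw [h]
  exact Submodule.mem_sup_right (Submodule.mem_span_singleton_self d)

/-- The residual update expresses the projection of `A d` as `α⁻¹ (p' - p)`. This keeps images
inside the enlarged span, and orthogonality of `p'` to that span then yields conjugacy. -/
theorem Krylov.next (hA : A.PosSemidef) {W : Submodule ℝ (Vec n)} {x r p d : Vec n} {α : ℝ}
    (K : Krylov A J0 p d W) (S : CGState A b c J0 Jneg Jpos x r p d)
    (hα : (α : EReal) = alphaCG A p d) {p' : Vec n}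
    (hp' : p' = proj J0 (r + α • mulv A d)) :
    Krylov A J0 p' (-p' + (‖p'‖ ^ 2 / ‖p‖ ^ 2) • d) (W ⊔ Submodule.span ℝ {d}) := by
  have hdW : d ∈ W ⊔ Submodule.span ℝ {d} :=
    Submodule.mem_sup_right (Submodule.mem_span_singleton_self d)
  have hpW : p ∈ W ⊔ Submodule.span ℝ {d} := by
    simpa using Submodule.sub_mem _ (Submodule.mem_sup_left K.add_mem) hdW
  have hle : W ⊔ Submodule.span ℝ {d} ≤ coordSubspace J0 :=
    sup_le K.le ((Submodule.span_singleton_le_iff_mem _ _).2 S.dir_mem)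
  have hstep : p' = p + α • proj J0 (mulv A d) := by rw [hp', S.projected_step]
  have hcurv := mul_inner_eq_of_eq_alphaCG S.ne_zero hα
  have hppos := S.norm_sq_pos
  have hα0 : α ≠ 0 := by
    rintro rfl
    rw [zero_mul] at hcurv
    exact hppos.ne hcurv
  have hPAd : proj J0 (mulv A d) = α⁻¹ • (p' - p) := by
    rw [hstep, add_sub_cancel_left, smul_smul, inv_mul_cancel₀ hα0, one_smul]
  have horth : ∀ w ∈ W ⊔ Submodule.span ℝ {d}, ⟪p', w⟫ = 0 := by
    intro w hw
    obtain ⟨u, hu, v, hv, rfl⟩ := Submodule.mem_sup.1 hw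
    obtain ⟨s, rfl⟩ := Submodule.mem_span_singleton.1 hv
    have h1 : ⟪p', u⟫ = 0 := by
      rw [hstep, inner_add_left, K.orthogonal u hu, inner_smul_left,
        inner_proj_left _ (K.le hu), real_inner_comm, K.conjugate u hu]
      simp
    rw [inner_add_right, h1, inner_smul_right, hp', S.inner_projected_step hα]
    simp
  have hp'mem : p' ∈ coordSubspace J0 := hp' ▸ proj_mem _ _
  have hp'd : ⟪p', mulv A d⟫ = α⁻¹ * ‖p'‖ ^ 2 := by
    rw [real_inner_comm, ← inner_proj_left _ hp'mem, hPAd, inner_smul_left, inner_sub_left,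
      real_inner_comm p' p, horth p hpW, real_inner_self_eq_norm_sq]
    simp
  refine ⟨hle, horth, ?_, ?_, ?_⟩
  · rw [add_neg_cancel_left]
    exact Submodule.smul_mem _ _ hdW
  · intro w hw
    obtain ⟨u, hu, v, hv, rfl⟩ := Submodule.mem_sup.1 hw
    obtain ⟨s, rfl⟩ := Submodule.mem_span_singleton.1 hv
    have h1 : ⟪u, mulv A p'⟫ = 0 := by
      rw [inner_mulv_comm hA, real_inner_comm, ← inner_proj_left _ hp'mem, real_inner_comm]
      exact horth _ (K.image u hu)
    have h2 : ⟪d, mulv A p'⟫ = α⁻¹ * ‖p'‖ ^ 2 := by rw [inner_mulv_comm hA, hp'd]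
    have h3 : ⟪d, mulv A d⟫ = α⁻¹ * ‖p‖ ^ 2 := by
      rw [← hcurv, inv_mul_cancel_left₀ hα0]
    simp only [mulv_add, mulv_neg, mulv_smul, inner_add_left, inner_add_right, inner_neg_right,
      inner_smul_left, inner_smul_right, h1, h2, h3, K.conjugate u hu, conj_trivial]
    -- What remains is conjugacy to `d` itself, for which the coefficient `‖p'‖² / ‖p‖²` is
    -- designed.
    have hpn := norm_ne_zero_iff.2 S.ne_zero
    field_simp
    ring
  · intro w hw
    obtain ⟨u, hu, v, hv, rfl⟩ := Submodule.mem_sup.1 hw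
    obtain ⟨s, rfl⟩ := Submodule.mem_span_singleton.1 hv
    have hd' : -p' + (‖p'‖ ^ 2 / ‖p‖ ^ 2) • d ∈ (W ⊔ Submodule.span ℝ {d}) ⊔
        Submodule.span ℝ {-p' + (‖p'‖ ^ 2 / ‖p‖ ^ 2) • d} :=
      Submodule.mem_sup_right (Submodule.mem_span_singleton_self _)
    have hp'W : p' ∈ (W ⊔ Submodule.span ℝ {d}) ⊔
        Submodule.span ℝ {-p' + (‖p'‖ ^ 2 / ‖p‖ ^ 2) • d} := by
      have := Submodule.sub_mem _
        (Submodule.smul_mem _ (‖p'‖ ^ 2 / ‖p‖ ^ 2) (Submodule.mem_sup_left hdW)) hd'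
      convert this using 1
      abel
    rw [mulv_add, proj_add, mulv_smul, proj_smul, hPAd]
    exact Submodule.add_mem _ (Submodule.mem_sup_left (K.image u hu))
      (Submodule.smul_mem _ _ (Submodule.smul_mem _ _
        (Submodule.sub_mem _ hp'W (Submodule.mem_sup_left hpW))))

/-- The conjugate gradient loop terminates, since the span of the previous directions grows. -/
theorem exists_TPCG1Loop (hA : A.PosSemidef)
    (hbdd : BddBelow (quad A b c '' face J0 Jneg Jpos)) (W : Submodule ℝ (Vec n))
    {x r p d : Vec n} (K : Krylov A J0 p d W) (S : CGState A b c J0 Jneg Jpos x r p d) :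
    ∃ y, TPCG1Loop A J0 Jneg Jpos 0 x r p d y := by
  obtain ⟨α, hα⟩ := S.exists_step hA hbdd
  by_cases hcut : (α : EReal) < alphaCG A p d
  · exact ⟨_, .cross hα hcut⟩
  by_cases hsmall : supNorm (proj J0 (r + α • mulv A d)) ≤ 0
  · exact ⟨_, .converged hα hcut rfl rfl hsmall⟩
  have hne := hsmall
  rw [supNorm_le_zero_iff] at hne
  have hlt := K.finrank_lt S.ne_zero
  have hle := Submodule.finrank_le (W ⊔ Submodule.span ℝ {d})
  obtain ⟨y, hy⟩ := exists_TPCG1Loop hA hbdd (W ⊔ Submodule.span ℝ {d})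
    (K.next hA S (CGState.eq_alphaCG hα hcut) rfl) (S.next hA hα hcut rfl hne)
  exact ⟨y, .iterate hα hcut rfl rfl hsmall hy⟩
termination_by Module.finrank ℝ (Vec n) - Module.finrank ℝ W
decreasing_by omega

/-! ### TPCG2 -/

theorem face_signs_mono {x : Vec n} (hx : x ∈ face J0 Jneg Jpos) :
    face (Izero x) (Ineg x) (Ipos x) ⊆ face J0 Jneg Jpos := by
  intro z hz
  refine ⟨fun j hj => hz.1 j (hx.1 j hj), fun j hj => ?_, fun j hj => ?_⟩
  · rcases (hx.2.1 j hj).lt_or_eq with h | h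
    · exact hz.2.1 j h
    · exact (hz.1 j h).le
  · rcases (hx.2.2 j hj).lt_or_eq with h | h
    · exact hz.2.2 j h
    · exact (hz.1 j h.symm).ge

theorem mem_face_signs (x : Vec n) : x ∈ face (Izero x) (Ineg x) (Ipos x) :=
  ⟨fun _ h => h, fun _ h => le_of_lt h, fun _ h => le_of_lt h⟩

theorem proj_eq_zero_mono {J J' : Set (Fin n)} (h : J ⊆ J') {x : Vec n} (hx : proj J x = 0) :
    proj J' x = 0 := by
  classical
  ext i
  have hi := congrArg (fun z : Vec n => z i) hx
  simp only [proj_apply] at hi ⊢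
  by_cases h1 : i ∈ J'
  · simp [h1]
  · rw [if_neg fun h2 => h1 (h h2)] at hi
    simpa [h1] using hi

theorem TPCG1.spec (hA : A.PosSemidef) {x y : Vec n} (h : TPCG1 A b c J0 Jneg Jpos x 0 y)
    (hx : x ∈ face J0 Jneg Jpos) (hne : proj J0 (mulv A x - b + c) ≠ 0) :
    y ∈ face J0 Jneg Jpos ∧ quad A b c y ≤ quad A b c x ∧
    ((∃ t : ℝ, 0 < t ∧ x + t • -proj J0 (mulv A x - b + c) ∈ face J0 Jneg Jpos) →
      quad A b c y < quad A b c x) ∧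
    (proj J0 (mulv A y - b + c) = 0 ∨ ∃ j ∈ Jneg ∪ Jpos, y j = 0) :=
  TPCG1Loop.spec hA h (CGState.initial hx hne)

theorem exists_TPCG1 (hA : A.PosSemidef) (hbdd : BddBelow (quad A b c '' face J0 Jneg Jpos))
    {x : Vec n} (hx : x ∈ face J0 Jneg Jpos) (hne : proj J0 (mulv A x - b + c) ≠ 0) :
    ∃ y, TPCG1 A b c J0 Jneg Jpos x 0 y :=
  exists_TPCG1Loop hA hbdd ⊥ (Krylov.initial _) (CGState.initial hx hne)

/-- The last test projects along an index set contained in `Izero y`, so it passes to `Izero y`.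
Strict descent is needed, and proved, only for the first call of TPCG1. -/
theorem TPCG2.spec (hA : A.PosSemidef) {x y : Vec n} (h : TPCG2 A b c 0 J0 Jneg Jpos x y)
    (hx : x ∈ face J0 Jneg Jpos) :
    y ∈ face J0 Jneg Jpos ∧ quad A b c y ≤ quad A b c x ∧
      proj (Izero y) (mulv A y - b + c) = 0 ∧
      (proj J0 (mulv A x - b + c) ≠ 0 →
        (∃ t : ℝ, 0 < t ∧ x + t • -proj J0 (mulv A x - b + c) ∈ face J0 Jneg Jpos) →
        quad A b c y < quad A b c x) := by
  induction h with
  | halt hsmall =>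
    rw [supNorm_le_zero_iff] at hsmall
    exact ⟨hx, le_rfl, proj_eq_zero_mono hx.1 hsmall, fun h => absurd hsmall h⟩
  | iterate hlarge hcall hrest ih =>
    rw [supNorm_le_zero_iff] at hlarge
    obtain ⟨h1, h2, h3, -⟩ := TPCG1.spec hA hcall hx hlarge
    obtain ⟨h5, h6, h7, -⟩ := ih (mem_face_signs _)
    exact ⟨face_signs_mono h1 h5, h6.trans h2, h7, fun _ h => h6.trans_lt (h3 h)⟩

/-- TPCG2 restarted on the face spanned by its iterate terminates, since each truncation fixes
one more variable at zero. -/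
theorem exists_TPCG2_signs (hA : A.PosSemidef) (x : Vec n)
    (hbdd : BddBelow (quad A b c '' face (Izero x) (Ineg x) (Ipos x))) :
    ∃ y, TPCG2 A b c 0 (Izero x) (Ineg x) (Ipos x) x y := by
  by_cases hsmall : supNorm (proj (Izero x) (mulv A x - b + c)) ≤ 0
  · exact ⟨x, .halt hsmall⟩
  have hne := hsmall
  rw [supNorm_le_zero_iff] at hne
  obtain ⟨x', hx'⟩ := exists_TPCG1 hA hbdd (mem_face_signs x) hne
  obtain ⟨h1, -, -, h4⟩ := TPCG1.spec hA hx' (mem_face_signs x) hne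
  rcases h4 with h4 | ⟨j, hj, hj0⟩
  · exact ⟨x', .iterate hsmall hx'
      (.halt ((supNorm_le_zero_iff _).2 (proj_eq_zero_mono h1.1 h4)))⟩
  · have hlt : (Izero x').ncard > (Izero x).ncard := by
      refine Set.ncard_lt_ncard ⟨h1.1, fun h => ?_⟩ (Set.toFinite _)
      have : x j = 0 := h hj0
      rcases hj with hj | hj
      · exact (show x j < 0 from hj).ne this
      · exact (show 0 < x j from hj).ne' this
    have hle : (Izero x').ncard ≤ Nat.card (Fin n) := Set.ncard_le_card _
    obtain ⟨y, hy⟩ := exists_TPCG2_signs hA x'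
      (hbdd.mono (Set.image_mono (face_signs_mono h1)))
    exact ⟨y, .iterate hsmall hx' hy⟩
termination_by Nat.card (Fin n) - (Izero x).ncard
decreasing_by omega

/-- The first call is treated apart: on a general face inequality constraints may be active at `x`
already, so a truncation need not increase the number of zeros. -/
theorem exists_TPCG2 (hA : A.PosSemidef) {x : Vec n} (hx : x ∈ face J0 Jneg Jpos)
    (hbdd : BddBelow (quad A b c '' face J0 Jneg Jpos)) :
    ∃ y, TPCG2 A b c 0 J0 Jneg Jpos x y := by
  by_cases hsmall : supNorm (proj J0 (mulv A x - b + c)) ≤ 0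
  · exact ⟨x, .halt hsmall⟩
  have hne := hsmall
  rw [supNorm_le_zero_iff] at hne
  obtain ⟨x', hx'⟩ := exists_TPCG1 hA hbdd hx hne
  obtain ⟨y, hy⟩ := exists_TPCG2_signs hA x'
    (hbdd.mono (Set.image_mono (face_signs_mono (TPCG1.spec hA hx' hx hne).1)))
  exact ⟨y, .iterate hsmall hx' hy⟩

/-! ### The minimum-norm subgradient -/

theorem f_add (hA : A.PosSemidef) (x d : Vec n) :
    f A b (x + d) = f A b x + ⟪mulv A x - b, d⟫ + 1 / 2 * ⟪d, mulv A d⟫ := by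
  simpa [quad] using quad_add (c := 0) (b := b) hA x d

/-- The expansion `f_add` is exact, with remainder of order `‖h‖²`. -/
theorem gradient_f (hA : A.PosSemidef) (x : Vec n) : gradient (f A b) x = mulv A x - b := by
  refine HasGradientAt.gradient ?_
  rw [hasGradientAt_iff_isLittleO_nhds_zero]
  have heq : (fun h : Vec n => f A b (x + h) - f A b x - ⟪mulv A x - b, h⟫) =
      fun h => 1 / 2 * ⟪h, mulv A h⟫ := by
    funext h; rw [f_add hA]; ring
  rw [heq]
  let M : Vec n →L[ℝ] Vec n := LinearMap.toContinuousLinearMap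
    { toFun := mulv A, map_add' := mulv_add, map_smul' := mulv_smul }
  have hM : ∀ h, ‖mulv A h‖ ≤ ‖M‖ * ‖h‖ := M.le_opNorm
  have hO : (fun h : Vec n => 1 / 2 * ⟪h, mulv A h⟫) =O[nhds 0] fun h => ‖h‖ ^ 2 := by
    refine Asymptotics.IsBigO.of_bound ‖M‖ (Filter.Eventually.of_forall fun h => ?_)
    have h1 := abs_real_inner_le_norm h (mulv A h)
    have h2 := mul_le_mul_of_nonneg_left (hM h) (norm_nonneg h)
    have h3 := abs_nonneg ⟪h, mulv A h⟫
    rw [Real.norm_eq_abs, abs_mul, Real.norm_of_nonneg (by positivity),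
      abs_of_pos (by norm_num : (0 : ℝ) < 1 / 2)]
    nlinarith
  exact hO.trans_isLittleO (Asymptotics.isLittleO_norm_pow_id one_lt_two)

/-- The indices whose variables are kept nonpositive in an iteration. -/
abbrev negSet (A : Matrix (Fin n) (Fin n) ℝ) (b : Vec n) (τ : ℝ) (x : Vec n) : Set (Fin n) :=
  Ineg x ∪ IzeroNeg A b τ x

/-- The indices whose variables are kept nonnegative in an iteration. -/
abbrev posSet (A : Matrix (Fin n) (Fin n) ℝ) (b : Vec n) (τ : ℝ) (x : Vec n) : Set (Fin n) :=
  Ipos x ∪ IzeroPos A b τ x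

/-- The face on which an iteration of GCG method 1 started at `x` works. -/
abbrev stepFace (A : Matrix (Fin n) (Fin n) ℝ) (b : Vec n) (τ : ℝ) (x : Vec n) : Set (Vec n) :=
  face (IzeroZero A b τ x) (negSet A b τ x) (posSet A b τ x)

/-- The projected gradient at `x` of the quadratic minimized in an iteration started at `x`. -/
noncomputable def projGrad (A : Matrix (Fin n) (Fin n) ℝ) (b : Vec n) (τ : ℝ) (x : Vec n) : Vec n :=
  proj (IzeroZero A b τ x) (mulv A x - b + cvec A b τ x)

/-- The four possible positions of an index relative to `x`. -/
theorem index_cases (hA : A.PosSemidef) (hτ : 0 ≤ τ) (x : Vec n) (i : Fin n) :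
    (i ∈ Ipos x ∧ i ∈ posSet A b τ x ∧ i ∉ IzeroZero A b τ x ∧ i ∉ negSet A b τ x ∧
      cvec A b τ x i = τ) ∨
    (i ∈ Ineg x ∧ i ∈ negSet A b τ x ∧ i ∉ IzeroZero A b τ x ∧ i ∉ posSet A b τ x ∧
      cvec A b τ x i = -τ) ∨
    (x i = 0 ∧ (mulv A x - b) i + τ < 0 ∧ i ∈ posSet A b τ x ∧ i ∉ IzeroZero A b τ x ∧
      i ∉ negSet A b τ x ∧ cvec A b τ x i = τ) ∨
    (x i = 0 ∧ 0 < (mulv A x - b) i - τ ∧ i ∈ negSet A b τ x ∧ i ∉ IzeroZero A b τ x ∧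
      i ∉ posSet A b τ x ∧ cvec A b τ x i = -τ) ∨
    (x i = 0 ∧ (mulv A x - b) i - τ ≤ 0 ∧ 0 ≤ (mulv A x - b) i + τ ∧ i ∈ IzeroZero A b τ x ∧
      i ∉ negSet A b τ x ∧ i ∉ posSet A b τ x ∧ cvec A b τ x i = 0) := by
  set g := (mulv A x - b) i with hg
  simp only [cvec, posSet, negSet, Ipos, Ineg, IzeroZero, IzeroPos, IzeroNeg, Izero,
    Set.mem_union, Set.mem_ofPred_eq, Set.mem_Icc, gradient_f hA, ← hg]
  rcases lt_trichotomy (x i) 0 with h | h | h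
  · right; left
    simp [h, h.ne, h.not_gt]
  · right; right
    by_cases h1 : g + τ < 0
    · left
      have h2 : ¬ 0 < g - τ := by linarith
      simp [h, h1, h1.not_ge]
      linarith
    · right
      by_cases h2 : 0 < g - τ
      · left
        have h3 : τ < g := by linarith
        simp [h, h1, h3, h3.not_ge]
      · right
        have h3 : ¬ τ < g := by linarith
        simp [h, h1, h3, not_lt.1 h1, not_lt.1 h3]
  · left
    simp [h, h.ne', h.not_gt]

theorem mem_stepFace (x : Vec n) : x ∈ stepFace A b τ x := by
  refine ⟨fun j hj => hj.1, fun j hj => ?_, fun j hj => ?_⟩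
  · rcases hj with hj | hj
    · exact le_of_lt hj
    · exact le_of_eq hj.1
  · rcases hj with hj | hj
    · exact le_of_lt hj
    · exact ge_of_eq hj.1

theorem inner_cvec_le (hA : A.PosSemidef) (hτ : 0 ≤ τ) (x z : Vec n) :
    ⟪cvec A b τ x, z⟫ ≤ τ * oneNorm z := by
  rw [inner_eq_sum, oneNorm, Finset.mul_sum]
  refine Finset.sum_le_sum fun i _ => ?_
  have h1 := mul_le_mul_of_nonneg_left (le_abs_self (z i)) hτ
  have h2 := mul_le_mul_of_nonneg_left (neg_abs_le (z i)) hτ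
  have h3 := mul_nonneg hτ (abs_nonneg (z i))
  rcases index_cases (b := b) hA hτ x i with h | h | h | h | h
  · rw [h.2.2.2.2]; exact h1
  · rw [h.2.2.2.2]; linarith
  · rw [h.2.2.2.2.2]; exact h1
  · rw [h.2.2.2.2.2]; linarith
  · rw [h.2.2.2.2.2.2]; linarith

theorem quad_le_F (hA : A.PosSemidef) (hτ : 0 ≤ τ) (x z : Vec n) :
    quad A b (cvec A b τ x) z ≤ F A b τ z :=
  add_le_add_right (inner_cvec_le hA hτ x z) _

theorem quad_eq_F (hA : A.PosSemidef) (hτ : 0 ≤ τ) {x z : Vec n} (hz : z ∈ stepFace A b τ x) :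
    quad A b (cvec A b τ x) z = F A b τ z := by
  rw [quad, F, inner_eq_sum, oneNorm, Finset.mul_sum]
  congr 1
  refine Finset.sum_congr rfl fun i _ => ?_
  obtain ⟨h0, hn, hp⟩ := hz
  rcases index_cases (b := b) hA hτ x i with h | h | h | h | h
  · rw [h.2.2.2.2, abs_of_nonneg (hp i h.2.1)]
  · rw [h.2.2.2.2, abs_of_nonpos (hn i h.2.1)]; ring
  · rw [h.2.2.2.2.2, abs_of_nonneg (hp i h.2.2.1)]
  · rw [h.2.2.2.2.2, abs_of_nonpos (hn i h.2.2.1)]; ring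
  · rw [h0 i h.2.2.2.1]; simp

/-- An inequality active at `x` belongs to `IzeroNeg` or `IzeroPos`, and the sign condition defining
that set makes the direction point inwards. -/
theorem projGrad_feasible (hA : A.PosSemidef) (hτ : 0 ≤ τ) (x : Vec n) :
    ∃ δ > (0 : ℝ), ∀ t : ℝ, 0 ≤ t → t ≤ δ → x + t • -projGrad A b τ x ∈ stepFace A b τ x := by
  classical
  refine exists_pos_add_smul_mem_face (mem_stepFace x) (neg_mem (proj_mem _ _)) ?_ ?_
  · intro j hj hx
    rcases index_cases (b := b) hA hτ x j with h | h | h | h | h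
    · exact absurd hx (ne_of_gt h.1)
    · exact absurd hx (ne_of_lt h.1)
    · exact absurd hj h.2.2.2.2.1
    · have := h.2.1
      simp only [projGrad, PiLp.neg_apply, proj_apply, if_neg h.2.2.2.1, PiLp.add_apply,
        h.2.2.2.2.2]
      linarith
    · exact absurd hj h.2.2.2.2.1
  · intro j hj hx
    rcases index_cases (b := b) hA hτ x j with h | h | h | h | h
    · exact absurd hx (ne_of_gt h.1)
    · exact absurd hx (ne_of_lt h.1)
    · have := h.2.1
      simp only [projGrad, PiLp.neg_apply, proj_apply, if_neg h.2.2.2.1, PiLp.add_apply,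
        h.2.2.2.2.2]
      linarith
    · exact absurd hj h.2.2.2.2.1
    · exact absurd hj h.2.2.2.2.2.1

/-- Componentwise: off `IzeroZero`, `cvec` is a subgradient of `τ|·|` at `x i`; on it, minus the
partial derivative of `f` is one. -/
theorem projGrad_mem_subdiff (hA : A.PosSemidef) (hτ : 0 ≤ τ) (x : Vec n) :
    projGrad A b τ x ∈ subdiff (F A b τ) x := by
  classical
  intro z
  have hf := f_add (b := b) hA x (z - x)
  rw [add_sub_cancel] at hf
  have hnn := inner_mulv_self_nonneg hA (z - x)
  have hl : τ * oneNorm x + ⟪projGrad A b τ x, z - x⟫ - ⟪mulv A x - b, z - x⟫ ≤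
      τ * oneNorm z := by
    simp only [inner_eq_sum, oneNorm, Finset.mul_sum, ← Finset.sum_add_distrib,
      ← Finset.sum_sub_distrib]
    refine Finset.sum_le_sum fun i _ => ?_
    have h1 := mul_le_mul_of_nonneg_left (le_abs_self (z i)) hτ
    have h2 := mul_le_mul_of_nonneg_left (neg_abs_le (z i)) hτ
    have hzx : (z - x) i = z i - x i := rfl
    simp only [projGrad, proj_apply]
    rcases index_cases (b := b) hA hτ x i with h | h | h | h | h
    · rw [if_neg h.2.2.1, abs_of_pos h.1, PiLp.add_apply, h.2.2.2.2, hzx]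
      linarith
    · rw [if_neg h.2.2.1, abs_of_neg h.1, PiLp.add_apply, h.2.2.2.2, hzx]
      linarith
    · rw [if_neg h.2.2.2.1, PiLp.add_apply, h.2.2.2.2.2, hzx, h.1, abs_zero]
      linarith
    · rw [if_neg h.2.2.2.1, PiLp.add_apply, h.2.2.2.2.2, hzx, h.1, abs_zero]
      linarith
    · rw [if_pos h.2.2.2.1, hzx, h.1, abs_zero]
      rcases abs_cases (z i) with ⟨ha, hz⟩ | ⟨ha, hz⟩ <;> rw [ha] <;> nlinarith [h.2.1, h.2.2.1]
  simp only [F]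
  linarith

/-- A directional derivative estimate along the negative projected gradient. -/
theorem norm_sq_projGrad_le_inner (hA : A.PosSemidef) (hτ : 0 ≤ τ) {x s : Vec n}
    (hs : s ∈ subdiff (F A b τ) x) :
    ‖projGrad A b τ x‖ ^ 2 ≤ ⟪s, projGrad A b τ x⟫ := by
  obtain ⟨δ, hδ, hmem⟩ := projGrad_feasible (b := b) hA hτ x
  set v := projGrad A b τ x with hv
  have hslope : ⟪mulv A x - b + cvec A b τ x, v⟫ = ‖v‖ ^ 2 :=
    (inner_proj_left _ (proj_mem _ _)).symm.trans (real_inner_self_eq_norm_sq v)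
  by_contra! hlt
  have hC := inner_mulv_self_nonneg hA v
  -- The subgradient inequality at `x - t v` is compared with the exact expansion of `F` on the
  -- face, then divided by `t`.
  have key : ∀ t, 0 < t → t ≤ δ → ‖v‖ ^ 2 - ⟪s, v⟫ ≤ t * (⟪v, mulv A v⟫ / 2) := by
    intro t ht htδ
    have h1 := hs (x + t • -v)
    rw [← quad_eq_F hA hτ (hmem t ht.le htδ), ← quad_eq_F hA hτ (mem_stepFace x),
      quad_add_smul hA, add_sub_cancel_left, mulv_neg, inner_neg_neg, inner_neg_right, hslope,
      inner_smul_right, inner_neg_right] at h1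
    have h2 : 0 ≤ t * (t * (⟪v, mulv A v⟫ / 2) - (‖v‖ ^ 2 - ⟪s, v⟫)) := by linarith
    linarith [nonneg_of_mul_nonneg_right h2 ht]
  set C := ⟪v, mulv A v⟫ / 2
  set e := ‖v‖ ^ 2 - ⟪s, v⟫ with he
  have he0 : 0 < e := by linarith
  have hC0 : 0 ≤ C := by positivity
  -- A step with `t * C < e`; the `+ 1` covers `C = 0`.
  have h1 := key (min δ (e / (C + 1))) (lt_min hδ (by positivity)) (min_le_left _ _)
  have h2 : min δ (e / (C + 1)) * C ≤ e / (C + 1) * C :=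
    mul_le_mul_of_nonneg_right (min_le_right _ _) hC0
  have h3 : e / (C + 1) * C < e := by
    rw [div_mul_eq_mul_div, div_lt_iff₀ (by linarith)]; linarith
  linarith

theorem isMinNormSubgradient_projGrad (hA : A.PosSemidef) (hτ : 0 ≤ τ) (x : Vec n) :
    IsMinNormSubgradient (F A b τ) x (projGrad A b τ x) := by
  refine ⟨projGrad_mem_subdiff hA hτ x, fun s hs => ?_⟩
  have h1 := norm_sq_projGrad_le_inner hA hτ hs
  have h2 := real_inner_le_norm s (projGrad A b τ x)
  by_contra! hlt
  have h3 := norm_nonneg s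
  nlinarith

/-- `‖v - g‖² ≤ ‖v‖² - ‖g‖² ≤ 0` for `g` the projected gradient. Thus the stopping test of any run
is a test on `projGrad`. -/
theorem IsMinNormSubgradient.eq_projGrad (hA : A.PosSemidef) (hτ : 0 ≤ τ) {x v : Vec n}
    (hv : IsMinNormSubgradient (F A b τ) x v) : v = projGrad A b τ x := by
  have h1 := norm_sq_projGrad_le_inner hA hτ hv.1
  have h2 := hv.2 _ (projGrad_mem_subdiff hA hτ x)
  have h3 := norm_sub_sq_real v (projGrad A b τ x)
  have h4 : ‖v - projGrad A b τ x‖ ^ 2 ≤ 0 := by nlinarith [norm_nonneg v]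
  exact sub_eq_zero.1 (norm_eq_zero.1 (pow_eq_zero_iff two_ne_zero |>.1
    (le_antisymm h4 (sq_nonneg _))))

theorem zero_mem_subdiff_iff {x : Vec n} :
    0 ∈ subdiff (F A b τ) x ↔ x ∈ optimalSet A b τ := by
  simp [subdiff, optimalSet]

theorem projGrad_eq_zero (hA : A.PosSemidef) (hτ : 0 ≤ τ) {x : Vec n}
    (hx : x ∈ optimalSet A b τ) : projGrad A b τ x = 0 := by
  have h := (isMinNormSubgradient_projGrad (b := b) hA hτ x).2 0 (zero_mem_subdiff_iff.2 hx)
  simpa using h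

/-! ### One iteration of GCG method 1 -/

/-- `x` minimizes `F` among the vectors that vanish wherever `x` does. -/
def FaceOptimal (A : Matrix (Fin n) (Fin n) ℝ) (b : Vec n) (τ : ℝ) (x : Vec n) : Prop :=
  ∀ z, Izero x ⊆ Izero z → F A b τ x ≤ F A b τ z

theorem exists_iteration (hA : A.PosSemidef) (hτ : 0 ≤ τ) (hopt : (optimalSet A b τ).Nonempty)
    (x : Vec n) :
    ∃ y, TPCG2 A b (cvec A b τ x) 0 (IzeroZero A b τ x) (negSet A b τ x) (posSet A b τ x) x y := by
  obtain ⟨xs, hxs⟩ := hopt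
  refine exists_TPCG2 hA (mem_stepFace x) ⟨F A b τ xs, ?_⟩
  rintro _ ⟨z, hz, rfl⟩
  rw [quad_eq_F hA hτ hz]
  exact hxs z

/-- Face optimality compares `F` even with points of other orthants: `y` minimizes the convex
quadratic on the subspace given by `Izero y`, and the quadratic lies below `F` with equality at `y`.
-/
theorem iteration_spec (hA : A.PosSemidef) (hτ : 0 ≤ τ) {x y : Vec n}
    (h : TPCG2 A b (cvec A b τ x) 0 (IzeroZero A b τ x) (negSet A b τ x) (posSet A b τ x) x y)
    (hx : projGrad A b τ x ≠ 0) : F A b τ y < F A b τ x ∧ FaceOptimal A b τ y := by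
  obtain ⟨h1, -, h3, h4⟩ := TPCG2.spec hA h (mem_stepFace x)
  constructor
  · obtain ⟨δ, hδ, hmem⟩ := projGrad_feasible (b := b) hA hτ x
    have := h4 hx ⟨δ, hδ, hmem δ (le_of_lt hδ) le_rfl⟩
    rwa [quad_eq_F hA hτ h1, quad_eq_F hA hτ (mem_stepFace x)] at this
  · intro z hz
    have hsub : z - y ∈ coordSubspace (Izero y) := fun j hj => by
      have hz' : z j = 0 := hz hj
      have hy' : y j = 0 := hj
      simp [hz', hy']
    have h5 := quad_add (b := b) (c := cvec A b τ x) hA y (z - y)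
    rw [← inner_proj_left _ hsub, h3, inner_zero_left, add_sub_cancel] at h5
    have h6 := inner_mulv_self_nonneg hA (z - y)
    have h7 := quad_le_F (b := b) hA hτ x z
    rw [← quad_eq_F hA hτ h1]
    linarith

/-! ### Counting zero sets -/

/-- The zero sets of face-optimal points with a smaller value than `x`. -/
def lowerZeroSets (A : Matrix (Fin n) (Fin n) ℝ) (b : Vec n) (τ : ℝ) (x : Vec n) :
    Set (Set (Fin n)) :=
  {J | ∃ z, Izero z = J ∧ FaceOptimal A b τ z ∧ F A b τ z < F A b τ x}

theorem lowerZeroSets_mono {x y : Vec n} (h : F A b τ y < F A b τ x) :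
    lowerZeroSets A b τ y ⊆ lowerZeroSets A b τ x :=
  fun _ ⟨z, h1, h2, h3⟩ => ⟨z, h1, h2, h3.trans h⟩

theorem FaceOptimal.notMem_lowerZeroSets {y : Vec n} (h : FaceOptimal A b τ y) :
    Izero y ∉ lowerZeroSets A b τ y :=
  fun ⟨z, h1, _, h3⟩ => (h z h1.ge).not_gt h3

theorem FaceOptimal.mem_optimalSet {y : Vec n} (h : FaceOptimal A b τ y)
    (hy : Izero y ∈ Istar A b τ) : y ∈ optimalSet A b τ := by
  obtain ⟨xs, hxs, hle⟩ := hy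
  exact fun z => (h xs hle).trans (hxs z)

/-- Each iteration removes at least the zero set of the new iterate from the finite family
`lowerZeroSets`. -/
theorem exists_GCG1 (hA : A.PosSemidef) (hτ : 0 ≤ τ) (hopt : (optimalSet A b τ).Nonempty)
    (hε : 0 ≤ ε) (x : Vec n) : ∃ k y, GCG1 A b τ ε k x y := by
  by_cases hsmall : supNorm (projGrad A b τ x) ≤ ε
  · exact ⟨0, x, .halt (isMinNormSubgradient_projGrad hA hτ x) hsmall⟩
  have hne : projGrad A b τ x ≠ 0 := fun h =>
    hsmall (((supNorm_le_zero_iff _).2 h).trans hε)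
  obtain ⟨x', hx'⟩ := exists_iteration hA hτ hopt x
  obtain ⟨hlt, hface⟩ := iteration_spec hA hτ hx' hne
  have hcard : (lowerZeroSets A b τ x').ncard < (lowerZeroSets A b τ x).ncard :=
    Set.ncard_lt_ncard ⟨lowerZeroSets_mono hlt,
      fun h => hface.notMem_lowerZeroSets (h ⟨x', rfl, hface, hlt⟩)⟩ (Set.toFinite _)
  obtain ⟨k, y, hy⟩ := exists_GCG1 hA hτ hopt hε x'
  exact ⟨k + 1, y, .iterate (isMinNormSubgradient_projGrad hA hτ x) hsmall hx' hy⟩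
termination_by (lowerZeroSets A b τ x).ncard

/-- The `+ 1` pays for the last iteration, whose result may have its zero set in `Istar`. -/
theorem GCG1.le_ncard (hA : A.PosSemidef) (hτ : 0 ≤ τ) (hε : 0 ≤ ε) {k : ℕ} {x y : Vec n}
    (h : GCG1 A b τ ε k x y) :
    k ≤ (lowerZeroSets A b τ x \ Istar A b τ).ncard + 1 := by
  induction h with
  | halt => exact Nat.zero_le _
  | @iterate k x v x' y hv hlarge hcall hrest ih =>
    rw [hv.eq_projGrad hA hτ] at hlarge
    have hne : projGrad A b τ x ≠ 0 := fun h =>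
      hlarge (((supNorm_le_zero_iff _).2 h).trans hε)
    obtain ⟨hlt, hface⟩ := iteration_spec hA hτ hcall hne
    -- If the run goes on from `x'`, then `x'` is not optimal and its zero set lies outside `Istar`.
    rcases hrest with _ | ⟨hv', hlarge', _, _⟩
    · exact Nat.le_add_left _ _
    rw [hv'.eq_projGrad hA hτ] at hlarge'
    have hout : Izero x' ∉ Istar A b τ := fun h => hlarge'
      (((supNorm_le_zero_iff _).2 (projGrad_eq_zero hA hτ (hface.mem_optimalSet h))).trans hε)
    have hcard : (lowerZeroSets A b τ x' \ Istar A b τ).ncard <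
        (lowerZeroSets A b τ x \ Istar A b τ).ncard :=
      Set.ncard_lt_ncard ⟨Set.sdiff_subset_sdiff_left (lowerZeroSets_mono hlt),
        fun h => hface.notMem_lowerZeroSets (h ⟨⟨x', rfl, hface, hlt⟩, hout⟩).1⟩
        (Set.toFinite _)
    omega

theorem ncard_compl_Istar_add_one_le_L : (Istar A b τ)ᶜ.ncard + 1 ≤ L A b τ := by
  -- The bound is essential: `sSup` of an unbounded set of naturals is `0`.
  refine Nat.succ_le_succ (le_csSup ⟨Nat.card (Set (Fin n)), ?_⟩ ?_)
  · rintro l ⟨C, hC, -⟩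
    simpa using Nat.card_le_card_of_injective C hC
  · let e := (Finite.equivFin ↥(Istar A b τ)ᶜ).symm
    exact ⟨fun i => e i, Subtype.val_injective.comp e.injective, fun i => (e i).2⟩

theorem GCG1.le_L (hA : A.PosSemidef) (hτ : 0 ≤ τ) (hε : 0 ≤ ε) {k : ℕ} {x y : Vec n}
    (h : GCG1 A b τ ε k x y) : k ≤ L A b τ := by
  have h1 := h.le_ncard hA hτ hε
  have h2 : (lowerZeroSets A b τ x \ Istar A b τ).ncard ≤ (Istar A b τ)ᶜ.ncard :=
    Set.ncard_le_ncard (fun _ h => h.2) (Set.toFinite _)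
  have h3 := ncard_compl_Istar_add_one_le_L (A := A) (b := b) (τ := τ)
  omega

theorem GCG1.exists_subgradient {k : ℕ} {x y : Vec n} (h : GCG1 A b τ ε k x y) :
    ∃ s ∈ subdiff (F A b τ) y, supNorm s ≤ ε := by
  induction h with
  | halt hv hsmall => exact ⟨_, hv.1, hsmall⟩
  | iterate _ _ _ _ ih => exact ih

end L1QP

theorem mainTheorem1 (n : ℕ) (A : Matrix (Fin n) (Fin n) ℝ) (hA : A.PosSemidef)
    (b : L1QP.Vec n) (τ : ℝ) (hτ : 0 ≤ τ)
    (hopt : (L1QP.optimalSet A b τ).Nonempty)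
    (x0 : L1QP.Vec n) (ε : ℝ) (hε : 0 ≤ ε) :
    (∃ k y, k ≤ L1QP.L A b τ ∧ L1QP.GCG1 A b τ ε k x0 y) ∧
    (∀ k y, L1QP.GCG1 A b τ ε k x0 y →
      k ≤ L1QP.L A b τ ∧
      (∃ s ∈ L1QP.subdiff (L1QP.F A b τ) y, L1QP.supNorm s ≤ ε) ∧
      (ε = 0 → y ∈ L1QP.optimalSet A b τ)) := by
  constructor
  · obtain ⟨k, y, h⟩ := L1QP.exists_GCG1 hA hτ hopt hε x0
    exact ⟨k, y, h.le_L hA hτ hε, h⟩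
  · intro k y h
    obtain ⟨s, hs, hsmall⟩ := h.exists_subgradient
    refine ⟨h.le_L hA hτ hε, ⟨s, hs, hsmall⟩, fun h0 => ?_⟩
    rw [h0, L1QP.supNorm_le_zero_iff] at hsmall
    exact L1QP.zero_mem_subdiff_iff.1 (hsmall ▸ hs)
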